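/- Let $(W,S)$ be a Coxeter system with Coxeter matrix $(m_{s,t})_{s,t\in S}$ ($S$ and $W$ possibly infinite), let $k$ be a commutative ring and let $A$ be a commutative $k$-algebra that is free as a $k$-module. Let $\rho\colon W\to\mathrm{Aut}_{k\text{-alg}}(A)$ be an action of $W$ on $A$ by $k$-algebra automorphisms, written $w.c=\rho_w(c)$, and let $a\colon S\to A^\times$, $s\mapsto a_s$, be a $W$-equivariant map, i.e. $w.a_s=a_t$ whenever $s,t\in S$ and $w\in W$ satisfy $wsw^{-1}=t$. Let $B_W$ be the Artin braid group of $(W,S)$, i.e. the group with generators $g_s$, $s\in S$, and the braid relations $g_sg_tg_s\cdots=g_tg_sg_t\cdots$ ($m_{s,t}$ factors on each side) for all $s\neq t$ with $m_{s,t}<\infty$; let $\pi\colon B_W\to W$, $g_s\mapsto s$, be the projection, and for $w\in W$ let $g_w=g_{s_1}\cdots g_{s_r}\in B_W$, where $w=s_1\cdots s_r$ is a reduced expression (by Matsumoto's theorem $g_w$ does not depend on it). Let $A\rtimes k[B_W]$ be the skew group ring of finite sums $\sum_{b\in B_W}c_b\,b$ with $c_b\in A$ and multiplication determined by $b\,c=(\pi(b).c)\,b$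 for $b\in B_W$, $c\in A$. The Marin ring $\mathcal{E}^{(W,S)}(A,\rho,a)$ is the quotient of $A\rtimes k[B_W]$ by the two-sided ideal generated by the elements $$g_s^2-a_s-(1-a_s)g_s,\qquad s\in S;$$ it is a left $A$-module by left multiplication, and the image of $g_w$ in it is again denoted by $g_w$. Then $\mathcal{E}^{(W,S)}(A,\rho,a)$ is a free left $A$-module with basis $\{g_w\}_{w\in W}$ if and only if, for every $s\in S$, $$(1-a_s)(1-\rho_s)=0\quad\text{in }\mathrm{End}_k(A),$$ where $a_s$ stands for the operator of multiplication by $a_s$ on $A$. -/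

import Mathlib

namespace CoxeterSystem

variable {B W : Type*} [Group W] {M : CoxeterMatrix B}

/-- The braid relators `(⋯ sᵢ sⱼ)(⋯ sⱼ sᵢ)⁻¹` (each factor an alternating word of length `mᵢⱼ`).
For `i = j` the relator is trivial, and so it is for `mᵢⱼ = ∞`, which Mathlib encodes
as `M i j = 0`. -/
def braidRelators (_cs : CoxeterSystem M W) : Set (FreeGroup B) :=
  Set.range fun p : B × B =>
    ((braidWord M p.1 p.2).map FreeGroup.of).prod *
      ((braidWord M p.2 p.1).map FreeGroup.of).prod⁻¹

/-- The Artin braid group `B_W` of the Coxeter system. -/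
def ArtinGroup (cs : CoxeterSystem M W) : Type _ := PresentedGroup cs.braidRelators

instance (cs : CoxeterSystem M W) : Group cs.ArtinGroup :=
  inferInstanceAs (Group (PresentedGroup cs.braidRelators))

/-- The standard generators of the Artin braid group. -/
def artinGen (cs : CoxeterSystem M W) (i : B) : cs.ArtinGroup :=
  PresentedGroup.of (rels := cs.braidRelators) i

theorem lift_braidRelators (cs : CoxeterSystem M W) :
    ∀ r ∈ cs.braidRelators, FreeGroup.lift cs.simple r = 1 := by
  rintro _ ⟨⟨i, j⟩, rfl⟩
  have h : ∀ ω : List B, FreeGroup.lift cs.simple (ω.map FreeGroup.of).prod = cs.wordProd ω := by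
    intro ω
    simp [wordProd, map_list_prod, Function.comp_def]
  simp only [map_mul, map_inv, h]
  rw [cs.wordProd_braidWord_eq i j, mul_inv_cancel]

/-- The projection `π : B_W → W`. -/
def artinProj (cs : CoxeterSystem M W) : cs.ArtinGroup →* W :=
  PresentedGroup.toGroup cs.lift_braidRelators

@[simp]
theorem artinProj_artinGen (cs : CoxeterSystem M W) (i : B) :
    cs.artinProj (cs.artinGen i) = cs.simple i :=
  PresentedGroup.toGroup.of cs.lift_braidRelators

/-- The canonical set-theoretical section `w ↦ g_w` of `π`: the product of the generators of
the Artin group along a reduced word of `w` (by Matsumoto's theorem, the choice of the reduced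
word is immaterial). -/
noncomputable def artinSection (cs : CoxeterSystem M W) (w : W) : cs.ArtinGroup :=
  ((cs.exists_isReduced w).choose.map cs.artinGen).prod

theorem artinProj_artinSection (cs : CoxeterSystem M W) (w : W) :
    cs.artinProj (cs.artinSection w) = w := by
  have h := (cs.exists_isReduced w).choose_spec.2
  conv_rhs => rw [h]
  simp [artinSection, wordProd, map_list_prod, Function.comp_def]

variable {A : Type*} [CommRing A] [MulSemiringAction W A]

/-- The Artin braid group acts on `A` through `π : B_W → W`. -/
instance (cs : CoxeterSystem M W) : MulSemiringAction cs.ArtinGroup A :=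
  MulSemiringAction.compHom A cs.artinProj

theorem artinGroup_smul_def (cs : CoxeterSystem M W) (b : cs.ArtinGroup) (c : A) :
    b • c = cs.artinProj b • c := rfl

/-- `W`-equivariance of `a : S → Aˣ` with respect to the (partially defined) conjugation action
on `S`: whenever `w s w⁻¹ = t` with `s, t ∈ S`, one has `w • a_s = a_t`. -/
def IsEquivariant (cs : CoxeterSystem M W) (a : B → Aˣ) : Prop :=
  ∀ (i j : B) (w : W), w * cs.simple i * w⁻¹ = cs.simple j → w • (a i : A) = (a j : A)

/-- The semidirect product `A ⋊ k[B_W]`, i.e. the skew group ring whose elements are finite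
sums `∑ c_b b` with `c_b ∈ A`, `b ∈ B_W`, and whose product obeys `b c = (π(b) • c) b`. -/
abbrev CrossedProduct (cs : CoxeterSystem M W) (A : Type*) [CommRing A]
    [MulSemiringAction W A] : Type _ :=
  SkewMonoidAlgebra A cs.ArtinGroup

/-- The elements `g_s² - a_s - (1 - a_s) g_s`. -/
noncomputable def heckeRelator (cs : CoxeterSystem M W) (a : B → Aˣ) (i : B) :
    cs.CrossedProduct A :=
  (SkewMonoidAlgebra.single (cs.artinGen i) 1) ^ 2
    - SkewMonoidAlgebra.single 1 (a i : A)
    - SkewMonoidAlgebra.single 1 (1 - (a i : A)) * SkewMonoidAlgebra.single (cs.artinGen i) 1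

/-- The two-sided ideal generated by the elements `g_s² - a_s - (1 - a_s) g_s`, `s ∈ S`. -/
noncomputable def heckeIdeal (cs : CoxeterSystem M W) (a : B → Aˣ) :
    TwoSidedIdeal (cs.CrossedProduct A) :=
  TwoSidedIdeal.span (Set.range (cs.heckeRelator a))

/-- The Marin ring: the quotient of `A ⋊ k[B_W]` by the two-sided ideal generated by the
elements `g_s² - a_s - (1 - a_s) g_s`. Its left `A`-module structure is induced by left
multiplication by `A` on `A ⋊ k[B_W]`. -/
abbrev MarinRing (cs : CoxeterSystem M W) (a : B → Aˣ) : Type _ :=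
  cs.CrossedProduct A ⧸ (cs.heckeIdeal a).asIdeal

/-- The element `g_w` of the Marin ring. -/
noncomputable def marinG (cs : CoxeterSystem M W) (a : B → Aˣ) (w : W) : cs.MarinRing a :=
  Ideal.Quotient.mk (cs.heckeIdeal a).asIdeal (SkewMonoidAlgebra.single (cs.artinSection w) 1)

end CoxeterSystem

/-!
Comparing the two expansions of `gᵢ² c = c gᵢ²` given by the quadratic relation yields
`(1 - aᵢ) (sᵢ • c - c) gᵢ = 0`, so the condition is forced as soon as the `g_w` are independent.

Conversely, by Matsumoto's theorem `g_w gᵢ` is `g_{w sᵢ}` whenever lengths add, so the quadratic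
relation makes the span of the `g_w` stable under right multiplication by the `gᵢ`, and the `g_w`
span. For independence, let `gᵢ` act on the free module `W →₀ A` by the expansion of `gᵢ g_w`. The
only difficulty is the braid relations for these operators. The condition `(1 - aᵢ) (1 - ρᵢ) = 0`
makes them commute with the operators of right multiplication by the `gⱼ`, and the latter generate
the whole module from `e₁`. So it suffices to compare the two sides of a braid relation on `e₁`,
where both give `e_w` for the longest element `w` of the dihedral subgroup.

Matsumoto's theorem and the commutation of left and right operators both rest on the exchange
condition, which comes from the action of `W` on `W × ℤ/2` that counts inversions modulo 2.
Matsumoto's theorem also needs that `sᵢ sⱼ` has order exactly `mᵢⱼ`, which is seen in the geometric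
representation.
-/

namespace Coxeter

open CoxeterSystem

section Reflection

open Module Polynomial.Chebyshev Real

theorem eval_S_add_eval_S_mul_sin (θ : ℝ) (n : ℤ) :
    ((S ℝ n).eval (2 * cos (2 * θ)) + (S ℝ (n - 1)).eval (2 * cos (2 * θ))) * sin θ =
      sin ((2 * n + 1) * θ) := by
  have sum_consecutive (k : ℤ) :
      ((S ℝ (k + 1)).eval (2 * cos (2 * θ)) + (S ℝ k).eval (2 * cos (2 * θ))) * sin θ +
        ((S ℝ k).eval (2 * cos (2 * θ)) + (S ℝ (k - 1)).eval (2 * cos (2 * θ))) * sin θ =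
      sin ((2 * (k + 1 : ℤ) + 1) * θ) + sin ((2 * k + 1) * θ) := by
    have hS := S_two_mul_real_cos (2 * θ) k
    rw [show (2 * ((k + 1 : ℤ) : ℝ) + 1) * θ = (k + 1) * (2 * θ) + θ by push_cast; ring,
      show (2 * (k : ℝ) + 1) * θ = (k + 1) * (2 * θ) - θ by ring, sin_add, sin_sub, ← hS,
      S_add_one]
    simp only [Polynomial.eval_sub, Polynomial.eval_mul, Polynomial.eval_X, sin_two_mul,
      cos_two_mul]
    ring
  induction n using Int.induction_on with
  | zero => simp
  | succ n ih =>
    have h := sum_consecutive n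
    rw [add_sub_cancel_right]
    linarith
  | pred n ih =>
    have h := sum_consecutive (-n - 1)
    rw [sub_add_cancel] at h
    linarith

variable {V : Type*} [AddCommGroup V] [Module ℝ V] {x y : V} {f g : Dual ℝ V} {θ : ℝ}

theorem sin_smul_reflection_mul_reflection_pow_apply_self (hf : f x = 2) (hg : g y = 2)
    (hfy : f y = -2 * cos θ) (hgx : g x = -2 * cos θ) (n : ℕ) :
    sin θ • ((reflection hf * reflection hg) ^ n) x =
      sin ((2 * n + 1) * θ) • x + sin (2 * n * θ) • y := by
  have ht : 2 * cos (2 * θ) = f y * g x - 2 := by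
    rw [hfy, hgx, cos_two_mul]
    ring
  have hx := eval_S_add_eval_S_mul_sin θ n
  have hy := S_two_mul_real_cos (2 * θ) (n - 1)
  rw [Int.cast_natCast] at hx
  rw [Int.cast_sub, Int.cast_natCast, Int.cast_one, sub_add_cancel, sin_two_mul] at hy
  rw [reflection_mul_reflection_pow_apply_self hf hg n _ ht, smul_add, smul_smul, smul_smul,
    hgx, ← hx, show 2 * (n : ℝ) * θ = n * (2 * θ) by ring, ← hy]
  congr 2 <;> ring

theorem reflection_mul_reflection_pow_apply_self_of_parallel (hf : f x = 2) (hg : g y = 2)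
    (hfy : f y = -2) (hgx : g x = -2) (n : ℕ) :
    ((reflection hf * reflection hg) ^ n) x = (2 * n + 1 : ℝ) • x + (2 * n : ℝ) • y := by
  rw [reflection_mul_reflection_pow_apply_self hf hg n 2 (by rw [hfy, hgx]; norm_num), hgx,
    S_eval_two, S_eval_two]
  push_cast
  module

theorem exists_sub_smul_sub_smul_mem_ker (hf : f x = 2) (hg : g y = 2)
    (hfy : f y = -2 * cos θ) (hgx : g x = -2 * cos θ) (hθ : sin θ ≠ 0) (z : V) :
    ∃ α β : ℝ, f (z - α • x - β • y) = 0 ∧ g (z - α • x - β • y) = 0 := by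
  refine ⟨(f z + cos θ * g z) / (2 * sin θ ^ 2), (g z + cos θ * f z) / (2 * sin θ ^ 2), ?_, ?_⟩
  · simp only [map_sub, map_smul, hf, hfy, smul_eq_mul]
    field_simp
    linear_combination f z * sin_sq_add_cos_sq θ
  · simp only [map_sub, map_smul, hg, hgx, smul_eq_mul]
    field_simp
    linear_combination g z * sin_sq_add_cos_sq θ

theorem reflection_mul_reflection_pow_apply_self_of_mul_eq_pi (hf : f x = 2) (hg : g y = 2)
    (hfy : f y = -2 * cos θ) (hgx : g x = -2 * cos θ) (hθ : sin θ ≠ 0) {m : ℕ}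
    (hm : m * θ = π) : ((reflection hf * reflection hg) ^ m) x = x := by
  apply smul_right_injective V hθ
  simp only [sin_smul_reflection_mul_reflection_pow_apply_self hf hg hfy hgx]
  rw [show (2 * (m : ℝ) + 1) * θ = θ + 2 * π by linear_combination 2 * hm,
    show 2 * (m : ℝ) * θ = 2 * π by linear_combination 2 * hm, sin_add_two_pi, sin_two_pi,
    zero_smul, add_zero]

theorem reflection_mul_reflection_pow_eq_one_of_mul_eq_pi (hf : f x = 2) (hg : g y = 2)
    (hfy : f y = -2 * cos θ) (hgx : g x = -2 * cos θ) (hθ : sin θ ≠ 0) {m : ℕ}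
    (hm : m * θ = π) : (reflection hf * reflection hg) ^ m = 1 := by
  have fixes_x : ((reflection hf * reflection hg) ^ m) x = x :=
    reflection_mul_reflection_pow_apply_self_of_mul_eq_pi hf hg hfy hgx hθ hm
  have fixes_y : ((reflection hf * reflection hg) ^ m) y = y := by
    have h := reflection_mul_reflection_pow_apply_self_of_mul_eq_pi hg hf hgx hfy hθ hm
    rw [← reflection_inv hg, ← reflection_inv hf, ← mul_inv_rev, inv_pow] at h
    exact ((LinearEquiv.symm_apply_eq _).1 h).symm
  have fixes_ker {z : V} (hfz : f z = 0) (hgz : g z = 0) :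
      ((reflection hf * reflection hg) ^ m) z = z := by
    rw [LinearEquiv.coe_pow]
    apply Function.iterate_fixed
    simp [reflection_apply, hfz, hgz]
  ext z
  obtain ⟨α, β, hfz, hgz⟩ := exists_sub_smul_sub_smul_mem_ker hf hg hfy hgx hθ z
  simpa [fixes_x, fixes_y] using fixes_ker hfz hgz

theorem sin_pi_div_pos {m : ℕ} (hm : 2 ≤ m) : 0 < sin (π / m) := by
  have h : (2 : ℝ) ≤ m := by exact_mod_cast hm
  exact sin_pos_of_pos_of_lt_pi (div_pos pi_pos (by linarith)) (div_lt_self pi_pos (by linarith))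

theorem dvd_of_reflection_mul_reflection_pow_eq_one (hf : f x = 2) (hg : g y = 2) {m : ℕ}
    (hm : 2 ≤ m) (hfy : f y = -2 * cos (π / m)) (hgx : g x = -2 * cos (π / m))
    (hxy : LinearIndependent ℝ ![x, y]) {n : ℕ}
    (hn : (reflection hf * reflection hg) ^ n = 1) : m ∣ n := by
  have hsin : sin (π / m) ≠ 0 := (sin_pi_div_pos hm).ne'
  have h : sin (π / m) • x + (0 : ℝ) • y =
      sin (2 * n * (π / m) + π / m) • x + sin (2 * n * (π / m)) • y := by
    rw [zero_smul, add_zero, ← add_one_mul,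
      ← sin_smul_reflection_mul_reflection_pow_apply_self hf hg hfy hgx, hn, LinearEquiv.coe_one,
      id_eq]
  obtain ⟨hx, hy⟩ := hxy.eq_of_pair h
  have hcos : cos (2 * n * (π / m)) = 1 := by
    rw [sin_add, ← hy, zero_mul, zero_add] at hx
    exact (mul_eq_right₀ hsin).1 hx.symm
  obtain ⟨k, hk⟩ := (cos_eq_one_iff _).1 hcos
  have hkn : (n : ℝ) = m * k := by
    field_simp at hk
    linarith
  exact Int.natCast_dvd_natCast.1 ⟨k, by exact_mod_cast hkn⟩

theorem orderOf_reflection_mul_reflection (hf : f x = 2) (hg : g y = 2) {m : ℕ} (hm : m ≠ 1)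
    (hfy : f y = -2 * cos (π / m)) (hgx : g x = -2 * cos (π / m))
    (hxy : LinearIndependent ℝ ![x, y]) : orderOf (reflection hf * reflection hg) = m := by
  rcases Nat.eq_zero_or_pos m with rfl | hpos
  · rw [orderOf_eq_zero_iff']
    intro n hn h
    have hx := reflection_mul_reflection_pow_apply_self_of_parallel hf hg
      (by simpa using hfy) (by simpa using hgx) n
    rw [h, LinearEquiv.coe_one, id_eq] at hx
    have hy := (hxy.eq_of_pair (s := 1) (t := 0) (by rw [← hx, one_smul, zero_smul, add_zero])).2
    simp only [zero_eq_mul, OfNat.ofNat_ne_zero, Nat.cast_eq_zero, false_or] at hy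
    exact hn.ne' hy
  · have hm2 : 2 ≤ m := by lia
    refine Nat.dvd_antisymm (orderOf_dvd_of_pow_eq_one ?_)
      (dvd_of_reflection_mul_reflection_pow_eq_one hf hg hm2 hfy hgx hxy (pow_orderOf_eq_one _))
    refine reflection_mul_reflection_pow_eq_one_of_mul_eq_pi hf hg hfy hgx
      (sin_pi_div_pos hm2).ne' ?_
    exact mul_div_cancel₀ π (by exact_mod_cast hpos.ne')

end Reflection

section GeometricRepresentation

variable {B : Type*} (M : CoxeterMatrix B)

/-- The linear form `v ↦ 2 (αᵢ, v)` on the space `B →₀ ℝ` of the geometric representation, where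
the simple roots `αⱼ` are the basis vectors and `(αᵢ, αⱼ) = -cos (π / mᵢⱼ)`. The value `π / 0 = 0`
gives the usual convention `(αᵢ, αⱼ) = -1` for `mᵢⱼ = ∞`. -/
noncomputable def geometricCoroot (i : B) : Module.Dual ℝ (B →₀ ℝ) :=
  Finsupp.linearCombination ℝ fun j => -2 * Real.cos (Real.pi / M i j)

theorem geometricCoroot_single (i j : B) :
    geometricCoroot M i (Finsupp.single j 1) = -2 * Real.cos (Real.pi / M i j) := by
  simp [geometricCoroot]

theorem geometricCoroot_single_self (i : B) : geometricCoroot M i (Finsupp.single i 1) = 2 := by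
  simp [geometricCoroot_single]

/-- The simple reflections of the geometric representation of the Coxeter group of `M`. -/
noncomputable def geometricReflection (i : B) : (B →₀ ℝ) ≃ₗ[ℝ] (B →₀ ℝ) :=
  Module.reflection (geometricCoroot_single_self M i)

theorem orderOf_geometricReflection_mul (i j : B) :
    orderOf (geometricReflection M i * geometricReflection M j) = M i j := by
  rcases eq_or_ne i j with rfl | hij
  · rw [M.diagonal, orderOf_eq_one_iff]
    exact mul_eq_one_iff_eq_inv.2 (Module.reflection_inv _).symm
  · have hindep : LinearIndependent ℝ ![Finsupp.single i (1 : ℝ), Finsupp.single j 1] := by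
      rw [LinearIndependent.pair_iff]
      intro c d h
      exact ⟨by simpa [hij] using DFunLike.congr_fun h i,
        by simpa [hij.symm] using DFunLike.congr_fun h j⟩
    exact orderOf_reflection_mul_reflection _ _ (M.off_diagonal i j hij)
      (geometricCoroot_single M i j) (by rw [geometricCoroot_single, M.symmetric]) hindep

theorem isLiftable_geometricReflection : M.IsLiftable (geometricReflection M) := fun i j =>
  orderOf_geometricReflection_mul M i j ▸ pow_orderOf_eq_one _

variable {M} {W : Type*} [Group W] (cs : CoxeterSystem M W)

theorem orderOf_simple_mul_simple (i j : B) : orderOf (cs.simple i * cs.simple j) = M i j := by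
  refine Nat.dvd_antisymm (orderOf_dvd_of_pow_eq_one (cs.simple_mul_simple_pow i j)) ?_
  have h := orderOf_map_dvd (cs.lift ⟨_, isLiftable_geometricReflection M⟩)
    (cs.simple i * cs.simple j)
  rwa [map_mul, cs.lift_apply_simple, cs.lift_apply_simple, orderOf_geometricReflection_mul] at h

end GeometricRepresentation

section ExchangeCondition

variable {B W : Type*} [Group W] {M : CoxeterMatrix B} (cs : CoxeterSystem M W)

theorem prod_map_alternatingWord_two_mul {G : Type*} [Monoid G] (f : B → G) (i j : B) (n : ℕ) :
    ((alternatingWord i j (2 * n)).map f).prod = (f i * f j) ^ n := by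
  induction n with
  | zero => simp [alternatingWord]
  | succ n ih => simp [mul_add, alternatingWord_succ, ih, pow_succ]

theorem rightInvSeq_alternatingWord (i j : B) (n : ℕ) :
    cs.rightInvSeq (alternatingWord i j n) =
      ((List.range n).map fun k => cs.simple j * (cs.simple i * cs.simple j) ^ k).reverse := by
  induction n generalizing i j with
  | zero => simp [alternatingWord]
  | succ n ih =>
    rw [alternatingWord_succ, rightInvSeq_concat, ih, List.range_succ_eq_map, List.map_cons,
      List.reverse_cons, List.map_map, List.map_reverse, List.map_map, pow_zero, mul_one,
      List.concat_eq_append]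
    congr 3
    funext k
    simp only [Function.comp_apply, MulAut.conj_apply, inv_simple]
    rw [← mul_pow_mul, pow_succ]
    simp only [mul_assoc]

theorem simple_mul_mul_simple_eq_simple_iff {i : B} {t : W} :
    cs.simple i * t * cs.simple i = cs.simple i ↔ t = cs.simple i := by
  rw [mul_eq_right, mul_eq_one_iff_inv_eq, inv_simple, eq_comm]

open Classical in
/-- The involution `(t, ε) ↦ (sᵢ t sᵢ, ε + [t = sᵢ])` of `W × ℤ/2`. Composed along a word, these
involutions count modulo 2 how often `t` occurs in the right inversion sequence of the word. -/
noncomputable def parityPerm (i : B) : Equiv.Perm (W × ZMod 2) :=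
  Function.Involutive.toPerm
    (fun p => (cs.simple i * p.1 * cs.simple i, p.2 + if p.1 = cs.simple i then 1 else 0)) (by
      rintro ⟨t, ε⟩
      refine Prod.ext (by simp [mul_assoc]) ?_
      simp only [simple_mul_mul_simple_eq_simple_iff, add_assoc, CharTwo.add_self_eq_zero,
        add_zero])

open Classical in
theorem parityPerm_apply (i : B) (t : W) (ε : ZMod 2) :
    parityPerm cs i (t, ε) =
      (cs.simple i * t * cs.simple i, ε + if t = cs.simple i then 1 else 0) := rfl

open Classical in
theorem prod_map_parityPerm_apply (ω : List B) (t : W) (ε : ZMod 2) :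
    (ω.map (parityPerm cs)).prod (t, ε) =
      (cs.wordProd ω * t * (cs.wordProd ω)⁻¹, ε + (cs.rightInvSeq ω).count t) := by
  induction ω with
  | nil => simp
  | cons i ω ih =>
    have h : cs.wordProd ω * (t * (cs.wordProd ω)⁻¹) = cs.simple i ↔
        (cs.wordProd ω)⁻¹ * (cs.simple i * cs.wordProd ω) = t := by
      rw [← mul_assoc, mul_inv_eq_iff_eq_mul, inv_mul_eq_iff_eq_mul, eq_comm]
    simp [ih, parityPerm_apply, rightInvSeq, wordProd_cons, List.count_cons, h, mul_assoc,
      add_assoc]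

theorem even_count_rightInvSeq_alternatingWord [DecidableEq W] (i j : B) (t : W) :
    Even ((cs.rightInvSeq (alternatingWord i j (2 * M i j))).count t) := by
  refine ⟨(cs.rightInvSeq (alternatingWord i j (M i j))).count t, ?_⟩
  have periodic (k : ℕ) : (cs.simple i * cs.simple j) ^ (M i j + k) =
      (cs.simple i * cs.simple j) ^ k := by
    rw [pow_add, cs.simple_mul_simple_pow, one_mul]
  simp [rightInvSeq_alternatingWord, two_mul, List.range_add, Function.comp_def, periodic]

theorem isLiftable_parityPerm : M.IsLiftable (parityPerm cs) := by
  classical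
  intro i j
  have hword : cs.wordProd (alternatingWord i j (2 * M i j)) = 1 := by
    rw [wordProd, prod_map_alternatingWord_two_mul, cs.simple_mul_simple_pow]
  ext1 ⟨t, ε⟩
  rw [← prod_map_alternatingWord_two_mul, prod_map_parityPerm_apply, hword,
    (ZMod.natCast_eq_zero_iff_even).2 (even_count_rightInvSeq_alternatingWord cs i j t)]
  simp

theorem count_rightInvSeq_eq_of_wordProd_eq [DecidableEq W] {ω τ : List B}
    (h : cs.wordProd ω = cs.wordProd τ) (t : W) :
    ((cs.rightInvSeq ω).count t : ZMod 2) = (cs.rightInvSeq τ).count t := by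
  have lift_wordProd (σ : List B) :
      cs.lift ⟨_, isLiftable_parityPerm cs⟩ (cs.wordProd σ) = (σ.map (parityPerm cs)).prod := by
    simp [wordProd, map_list_prod, Function.comp_def]
  have hperm := congrArg (fun w => (cs.lift ⟨_, isLiftable_parityPerm cs⟩ w) (t, 0)) h
  simp only [lift_wordProd, prod_map_parityPerm_apply, Prod.mk.injEq, zero_add] at hperm
  convert hperm.2

theorem simple_mem_rightInvSeq_of_isRightDescent {ω : List B} {i : B}
    (h : cs.IsRightDescent (cs.wordProd ω) i) : cs.simple i ∈ cs.rightInvSeq ω := by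
  classical
  by_contra hmem
  obtain ⟨τ, hτ, hτw⟩ := cs.exists_isReduced (cs.wordProd ω * cs.simple i)
  have hcount := count_rightInvSeq_eq_of_wordProd_eq cs ((cs.wordProd_concat i ω).trans hτw)
    (cs.simple i)
  have hconj : cs.simple i ∉ (cs.rightInvSeq ω).map (MulAut.conj (cs.simple i)) := by
    rw [List.mem_map]
    rintro ⟨t, ht, hti⟩
    rw [MulAut.conj_apply, inv_simple, simple_mul_mul_simple_eq_simple_iff] at hti
    exact hmem (hti ▸ ht)
  have hmem' : cs.simple i ∈ cs.rightInvSeq τ := by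
    by_contra hmem'
    rw [rightInvSeq_concat, List.concat_eq_append, List.count_append, List.count_singleton_self,
      List.count_eq_zero.2 hmem', List.count_eq_zero.2 hconj] at hcount
    exact absurd hcount (by decide)
  have hlt := (cs.isRightInversion_of_mem_rightInvSeq hτ hmem').2
  rw [← hτw, simple_mul_simple_cancel_right] at hlt
  exact lt_asymm h hlt

theorem exists_wordProd_mul_simple_eq_wordProd_eraseIdx {ω : List B} {i : B}
    (h : cs.IsRightDescent (cs.wordProd ω) i) :
    ∃ k < ω.length, cs.wordProd ω * cs.simple i = cs.wordProd (ω.eraseIdx k) := by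
  obtain ⟨k, hk, hki⟩ := List.mem_iff_getElem.mp (simple_mem_rightInvSeq_of_isRightDescent cs h)
  refine ⟨k, by simpa using hk, ?_⟩
  rw [← wordProd_mul_getD_rightInvSeq, List.getD_eq_getElem _ 1 hk, hki]

theorem simple_mul_eq_mul_simple_of_length_lt {w : W} {i j : B}
    (h : cs.length (cs.simple i * w * cs.simple j) = cs.length w)
    (hi : cs.length w < cs.length (cs.simple i * w))
    (hj : cs.length w < cs.length (w * cs.simple j)) :
    cs.simple i * w = w * cs.simple j := by
  obtain ⟨ω, hω, rfl⟩ := cs.exists_isReduced w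
  have hdesc : cs.IsRightDescent (cs.wordProd (i :: ω)) j := by
    rw [IsRightDescent, wordProd_cons, h]
    exact hi
  obtain ⟨k, hk, hkw⟩ := exists_wordProd_mul_simple_eq_wordProd_eraseIdx cs hdesc
  rw [wordProd_cons] at hkw
  cases k with
  | zero =>
    rw [List.eraseIdx_cons_zero] at hkw
    simpa only [inv_simple] using eq_mul_inv_of_mul_eq hkw
  | succ k =>
    rw [List.eraseIdx_cons_succ, wordProd_cons, mul_assoc, mul_right_inj] at hkw
    rw [List.length_cons] at hk
    have hle := cs.length_wordProd_le (ω.eraseIdx k)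
    rw [← hkw, List.length_eraseIdx_of_lt (by lia)] at hle
    rw [hω.eq] at hj
    lia

theorem simple_mul_eq_mul_simple_of_length_eq {w : W} {i j : B}
    (h : cs.length (cs.simple i * w * cs.simple j) = cs.length w)
    (hij : cs.length (cs.simple i * w) = cs.length (w * cs.simple j)) :
    cs.simple i * w = w * cs.simple j := by
  rcases lt_or_gt_of_ne (cs.length_simple_mul_ne w i) with hi | hi
  · have hw := simple_mul_eq_mul_simple_of_length_lt cs (w := cs.simple i * w) (i := i) (j := j)
      (by simpa using hij.symm) (by simpa using hi) (by rwa [h])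
    rw [simple_mul_simple_cancel_left] at hw
    conv_rhs => rw [hw, simple_mul_simple_cancel_right]
  · exact simple_mul_eq_mul_simple_of_length_lt cs h hi (hij ▸ hi)

end ExchangeCondition

section Matsumoto

variable {B W : Type*} [Group W] {M : CoxeterMatrix B} (cs : CoxeterSystem M W)

theorem isReduced_alternatingWord {i j : B} (hij : i ≠ j) {n : ℕ} (hn : M i j = 0 ∨ n ≤ M i j) :
    cs.IsReduced (alternatingWord i j n) := by
  induction n generalizing i j with
  | zero => simp [CoxeterSystem.IsReduced, alternatingWord]
  | succ n ih =>
    have hji : cs.IsReduced (alternatingWord j i n) :=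
      ih hij.symm (by rw [M.symmetric]; lia)
    rw [alternatingWord_succ, CoxeterSystem.IsReduced, wordProd_concat, List.length_concat,
      ← hji.eq, ← cs.not_isRightDescent_iff]
    intro hdesc
    have hmem := simple_mem_rightInvSeq_of_isRightDescent cs hdesc
    simp only [rightInvSeq_alternatingWord, List.mem_reverse, List.mem_map, List.mem_range] at hmem
    obtain ⟨k, hk, hkj⟩ := hmem
    have hpow : (cs.simple j * cs.simple i) ^ (k + 1) = 1 := by
      rw [pow_succ', mul_assoc, hkj, simple_mul_simple_self]
    have hdvd := orderOf_dvd_of_pow_eq_one hpow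
    rw [orderOf_simple_mul_simple, M.symmetric] at hdvd
    rcases hn with h0 | hn
    · simp [h0] at hdvd
    · have := Nat.le_of_dvd k.succ_pos hdvd
      lia

theorem isReduced_braidWord (i j : B) : cs.IsReduced (braidWord M i j) := by
  rcases eq_or_ne i j with rfl | hij
  · simp [braidWord, CoxeterSystem.IsReduced, alternatingWord]
  · exact isReduced_alternatingWord cs hij (Or.inr le_rfl)

theorem exists_wordProd_append_mul_simple_eq {ω τ : List B} {j : B}
    (hτ : cs.IsReduced (τ ++ [j])) (h : cs.IsRightDescent (cs.wordProd (ω ++ τ)) j) :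
    ∃ k < ω.length, cs.wordProd (ω ++ τ) * cs.simple j = cs.wordProd (ω.eraseIdx k ++ τ) := by
  obtain ⟨k, hk, hkw⟩ := exists_wordProd_mul_simple_eq_wordProd_eraseIdx cs h
  by_cases hkω : k < ω.length
  · exact ⟨k, hkω, by rw [hkw, List.eraseIdx_append_of_lt_length hkω]⟩
  · exfalso
    rw [List.length_append] at hk
    rw [List.eraseIdx_append_of_length_le (by lia), wordProd_append, wordProd_append, mul_assoc,
      mul_right_inj, ← wordProd_concat, List.concat_eq_append] at hkw
    have hle := cs.length_wordProd_le (τ.eraseIdx (k - ω.length))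
    rw [← hkw, hτ.eq, List.length_append, List.length_eraseIdx_of_lt (by lia),
      List.length_singleton] at hle
    lia

theorem exists_isReduced_append_alternatingWord {w : W} {i j : B} (hij : i ≠ j)
    (hi : cs.IsRightDescent w i) (hj : cs.IsRightDescent w j) {n : ℕ}
    (hn : M i j = 0 ∨ n ≤ M i j) :
    ∃ ω, cs.IsReduced (ω ++ alternatingWord i j n) ∧
      w = cs.wordProd (ω ++ alternatingWord i j n) := by
  induction n generalizing i j with
  | zero => simpa [alternatingWord] using cs.exists_isReduced w
  | succ n ih =>
    obtain ⟨ω, hω, rfl⟩ := ih hij.symm hj hi (by rw [M.symmetric]; lia)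
    have hred := isReduced_alternatingWord cs hij hn
    rw [alternatingWord_succ, List.concat_eq_append] at hred ⊢
    obtain ⟨k, hk, hkw⟩ := exists_wordProd_append_mul_simple_eq cs hred hj
    have hw : cs.wordProd (ω ++ alternatingWord j i n) =
        cs.wordProd (ω.eraseIdx k ++ (alternatingWord j i n ++ [j])) := by
      rw [← List.append_assoc, ← List.concat_eq_append, wordProd_concat, ← hkw,
        simple_mul_simple_cancel_right]
    refine ⟨ω.eraseIdx k, ?_, hw⟩
    rw [CoxeterSystem.IsReduced, ← hw, hω.eq]
    simp only [List.length_append, List.length_eraseIdx_of_lt hk, List.length_singleton]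
    lia

theorem coxeterMatrix_ne_zero_of_isRightDescent {w : W} {i j : B} (hij : i ≠ j)
    (hi : cs.IsRightDescent w i) (hj : cs.IsRightDescent w j) : M i j ≠ 0 := by
  intro h0
  obtain ⟨ω, hω, hw⟩ := exists_isReduced_append_alternatingWord cs hij hi hj
    (n := cs.length w + 1) (Or.inl h0)
  have hlen := hω.eq
  rw [← hw, List.length_append, length_alternatingWord] at hlen
  lia

theorem singleton_suffix_braidWord {i j : B} (hM : M i j ≠ 0) : [j] <:+ braidWord M i j := by
  obtain ⟨m, hm⟩ := Nat.exists_eq_succ_of_ne_zero hM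
  rw [braidWord, hm, alternatingWord_succ, List.concat_eq_append]
  exact List.suffix_append _ _

theorem exists_singleton_suffix {α : Type*} {l : List α} {n : ℕ} (h : l.length = n + 1) :
    ∃ x, [x] <:+ l :=
  ⟨_, _, List.dropLast_append_getLast (List.ne_nil_of_length_eq_add_one h)⟩

variable {cs} in
theorem isReduced_of_isReduced_append_left {ω τ : List B} (h : cs.IsReduced (ω ++ τ)) :
    cs.IsReduced ω := by
  simpa using h.take ω.length

variable {cs} in
theorem isRightDescent_of_singleton_suffix {ω : List B} {i : B} (hω : cs.IsReduced ω)
    (hi : [i] <:+ ω) : cs.IsRightDescent (cs.wordProd ω) i := by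
  obtain ⟨τ, rfl⟩ := hi
  rw [IsRightDescent, hω.eq, wordProd_append, wordProd_singleton, simple_mul_simple_cancel_right,
    List.length_append, List.length_singleton, Nat.lt_succ_iff]
  exact cs.length_wordProd_le τ

theorem exists_isReduced_append_braidWord {w : W} {i j : B} (hij : i ≠ j)
    (hi : cs.IsRightDescent w i) (hj : cs.IsRightDescent w j) :
    ∃ ω, cs.IsReduced (ω ++ braidWord M i j) ∧ cs.IsReduced (ω ++ braidWord M j i) ∧
      w = cs.wordProd (ω ++ braidWord M i j) ∧ w = cs.wordProd (ω ++ braidWord M j i) := by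
  obtain ⟨ω, hω, hw⟩ := exists_isReduced_append_alternatingWord cs hij hi hj
    (Or.inr (le_refl (M i j)))
  have hw' : w = cs.wordProd (ω ++ braidWord M j i) := by
    rw [hw, wordProd_append, wordProd_append, cs.wordProd_braidWord_eq]
  refine ⟨ω, hω, ?_, hw, hw'⟩
  rw [CoxeterSystem.IsReduced, ← hw', hw, hω.eq]
  simp [M.symmetric i j]

/-- **Matsumoto's theorem**. Words with the same last letter are handled by induction on the length;
words ending in `i ≠ j` are linked through reduced words of the same element that end in the two
braid words of `i` and `j`. -/
theorem prod_map_eq_of_isReduced {G : Type*} [Monoid G] {f : B → G}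
    (hf : ∀ i j, ((braidWord M i j).map f).prod = ((braidWord M j i).map f).prod)
    {ω τ : List B} (hω : cs.IsReduced ω) (hτ : cs.IsReduced τ)
    (h : cs.wordProd ω = cs.wordProd τ) : (ω.map f).prod = (τ.map f).prod := by
  induction hn : cs.length (cs.wordProd ω) generalizing ω τ with
  | zero =>
    rw [List.length_eq_zero_iff.1 (hω.eq.symm.trans hn),
      List.length_eq_zero_iff.1 (hτ.eq.symm.trans (h ▸ hn))]
  | succ n ih =>
    have of_same_last {σ σ' : List B} {i : B} (hσ : cs.IsReduced σ) (hσ' : cs.IsReduced σ')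
        (hωσ : cs.wordProd ω = cs.wordProd σ) (hωσ' : cs.wordProd ω = cs.wordProd σ')
        (hi : [i] <:+ σ) (hi' : [i] <:+ σ') : (σ.map f).prod = (σ'.map f).prod := by
      obtain ⟨σ, rfl⟩ := hi
      obtain ⟨σ', rfl⟩ := hi'
      have hσ_left := isReduced_of_isReduced_append_left hσ
      rw [List.map_append, List.map_append, List.prod_append, List.prod_append,
        ih hσ_left (isReduced_of_isReduced_append_left hσ')
          (by simpa [wordProd_append] using hωσ.symm.trans hωσ')]
      have hlen := hσ.eq
      rw [← hωσ, hn, List.length_append, List.length_singleton] at hlen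
      rw [hσ_left.eq, ← Nat.succ.inj hlen]
    obtain ⟨i, hi⟩ := exists_singleton_suffix (hω.eq.symm.trans hn)
    obtain ⟨j, hj⟩ := exists_singleton_suffix (hτ.eq.symm.trans (h ▸ hn))
    rcases eq_or_ne i j with rfl | hij
    · exact of_same_last hω hτ rfl h hi hj
    have hi_desc := isRightDescent_of_singleton_suffix hω hi
    have hj_desc := h ▸ isRightDescent_of_singleton_suffix hτ hj
    have hM : M i j ≠ 0 := coxeterMatrix_ne_zero_of_isRightDescent cs hij hi_desc hj_desc
    obtain ⟨u, hij_red, hji_red, hωij, hωji⟩ :=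
      exists_isReduced_append_braidWord cs hij hi_desc hj_desc
    calc (ω.map f).prod = ((u ++ braidWord M j i).map f).prod :=
          of_same_last hω hji_red rfl hωji hi
            (List.suffix_append_of_suffix (singleton_suffix_braidWord (M.symmetric i j ▸ hM)))
      _ = ((u ++ braidWord M i j).map f).prod := by
          rw [List.map_append, List.map_append, List.prod_append, List.prod_append, hf]
      _ = (τ.map f).prod :=
          of_same_last hij_red hτ hωij h
            (List.suffix_append_of_suffix (singleton_suffix_braidWord hM)) hj

end Matsumoto

section ArtinGroup

variable {B W : Type*} [Group W] {M : CoxeterMatrix B} (cs : CoxeterSystem M W)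

theorem prod_map_artinGen (ω : List B) :
    (ω.map cs.artinGen).prod =
      PresentedGroup.mk cs.braidRelators (ω.map FreeGroup.of).prod := by
  rw [map_list_prod, List.map_map]
  rfl

theorem prod_artinGen_braidWord (i j : B) :
    ((braidWord M i j).map cs.artinGen).prod = ((braidWord M j i).map cs.artinGen).prod := by
  rw [prod_map_artinGen, prod_map_artinGen]
  exact PresentedGroup.mk_eq_mk_of_mul_inv_mem ⟨(i, j), rfl⟩

theorem mem_closure_range_artinGen (b : cs.ArtinGroup) :
    b ∈ Subgroup.closure (Set.range cs.artinGen) :=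
  (PresentedGroup.closure_range_of cs.braidRelators).ge (Subgroup.mem_top b)

theorem lift_braidRelators_eq_one {G : Type*} [Group G] {f : B → G}
    (hf : ∀ i j, ((braidWord M i j).map f).prod = ((braidWord M j i).map f).prod) :
    ∀ r ∈ cs.braidRelators, FreeGroup.lift f r = 1 := by
  rintro _ ⟨⟨i, j⟩, rfl⟩
  rw [map_mul, map_inv, mul_inv_eq_one, map_list_prod, map_list_prod, List.map_map, List.map_map]
  simpa only [Function.comp_def, FreeGroup.lift_apply_of] using hf i j

/-- The homomorphism out of the Artin group given by a family satisfying the braid relations. -/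
def artinLift {G : Type*} [Group G] (f : B → G)
    (hf : ∀ i j, ((braidWord M i j).map f).prod = ((braidWord M j i).map f).prod) :
    cs.ArtinGroup →* G :=
  PresentedGroup.toGroup (lift_braidRelators_eq_one cs hf)

theorem artinLift_artinGen {G : Type*} [Group G] {f : B → G}
    (hf : ∀ i j, ((braidWord M i j).map f).prod = ((braidWord M j i).map f).prod) (i : B) :
    artinLift cs f hf (cs.artinGen i) = f i :=
  PresentedGroup.toGroup.of _

theorem artinSection_wordProd {ω : List B} (hω : cs.IsReduced ω) :
    cs.artinSection (cs.wordProd ω) = (ω.map cs.artinGen).prod :=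
  have h := (cs.exists_isReduced (cs.wordProd ω)).choose_spec
  prod_map_eq_of_isReduced cs (prod_artinGen_braidWord cs) h.1 hω h.2.symm

theorem artinSection_one : cs.artinSection 1 = 1 := by
  simpa using artinSection_wordProd cs (ω := []) (by simp [CoxeterSystem.IsReduced])

theorem artinSection_simple (i : B) : cs.artinSection (cs.simple i) = cs.artinGen i := by
  simpa using artinSection_wordProd cs (ω := [i]) (by simp [CoxeterSystem.IsReduced])

theorem artinSection_mul_artinGen {w : W} {i : B} (h : ¬cs.IsRightDescent w i) :
    cs.artinSection w * cs.artinGen i = cs.artinSection (w * cs.simple i) := by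
  obtain ⟨ω, hω, rfl⟩ := cs.exists_isReduced w
  have hωi : cs.IsReduced (ω.concat i) := by
    rw [CoxeterSystem.IsReduced, wordProd_concat, cs.not_isRightDescent_iff.1 h, hω.eq,
      List.length_concat]
  rw [artinSection_wordProd cs hω, ← wordProd_concat, artinSection_wordProd cs hωi,
    List.concat_eq_append, List.map_append, List.prod_append, List.map_singleton,
    List.prod_singleton]

end ArtinGroup

end Coxeter

namespace MarinRing

open CoxeterSystem Coxeter

variable {B W A : Type*} [Group W] {M : CoxeterMatrix B} (cs : CoxeterSystem M W)
  [CommRing A] (a : B → Aˣ)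

open Classical in
/-- The expansion of `gᵢ g_w` in the free module with basis `(g_w)`, as prescribed by the
quadratic relation. -/
noncomputable def leftMulBasis (i : B) (w : W) : W →₀ A :=
  if cs.IsLeftDescent w i then
    (a i : A) • Finsupp.single (cs.simple i * w) 1 + (1 - (a i : A)) • Finsupp.single w 1
  else Finsupp.single (cs.simple i * w) 1

variable {cs} in
theorem leftMulBasis_of_isLeftDescent {i : B} {w : W} (h : cs.IsLeftDescent w i) :
    leftMulBasis cs a i w =
      (a i : A) • Finsupp.single (cs.simple i * w) 1 + (1 - (a i : A)) • Finsupp.single w 1 :=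
  if_pos h

variable {cs} in
theorem leftMulBasis_of_not_isLeftDescent {i : B} {w : W} (h : ¬cs.IsLeftDescent w i) :
    leftMulBasis cs a i w = Finsupp.single (cs.simple i * w) 1 :=
  if_neg h

variable [MulSemiringAction W A]

/-- The condition `(1 - aᵢ) (1 - ρᵢ) = 0` for all `i`, which characterizes freeness of the Marin
ring. It is written elementwise, so that no base ring `k` is involved. -/
def AnnihilatesDifferences : Prop :=
  ∀ (i : B) (c : A), (1 - (a i : A)) * (cs.simple i • c) = (1 - (a i : A)) * c

variable {cs a} in
theorem simple_smul_of_isEquivariant (ha : cs.IsEquivariant a) (i : B) :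
    cs.simple i • (a i : A) = a i :=
  ha i i _ (by simp)

variable {cs a} in
theorem simple_smul_inv_of_isEquivariant (ha : cs.IsEquivariant a) (i : B) :
    cs.simple i • ((a i)⁻¹ : Aˣ).val = ((a i)⁻¹ : Aˣ).val := by
  apply Units.eq_inv_of_mul_eq_one_left
  conv_lhs => rw [← simple_smul_of_isEquivariant ha i]
  rw [← smul_mul', Units.mul_inv, smul_one]

section Multiplication

open Classical in
/-- The expansion of `g_w gⱼ` in the free module with basis `(g_w)`. The coefficients of the
quadratic relation for `gⱼ` are moved to the left of `g_w`, hence the action of `w` on them. -/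
noncomputable def rightMulBasis (j : B) (w : W) : W →₀ A :=
  if cs.IsRightDescent w j then
    (w • (a j : A)) • Finsupp.single (w * cs.simple j) 1
      + (1 - w • (a j : A)) • Finsupp.single w 1
  else Finsupp.single (w * cs.simple j) 1

variable {cs} in
theorem rightMulBasis_of_not_isRightDescent {j : B} {w : W} (h : ¬cs.IsRightDescent w j) :
    rightMulBasis cs a j w = Finsupp.single (w * cs.simple j) 1 :=
  if_neg h

/-- Left multiplication by `gᵢ` on the free module with basis `(g_w)`: it is only semilinear,
since `gᵢ c = (sᵢ • c) gᵢ`. -/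
noncomputable def leftMul (i : B) : AddMonoid.End (W →₀ A) :=
  Finsupp.liftAddHom fun w =>
    ((LinearMap.toSpanSingleton A (W →₀ A) (leftMulBasis cs a i w)).toAddMonoidHom).comp
      (DistribSMul.toAddMonoidHom A (cs.simple i))

/-- Right multiplication by `gⱼ` on the free module with basis `(g_w)`. -/
noncomputable def rightMul (j : B) : (W →₀ A) →ₗ[A] (W →₀ A) :=
  Finsupp.linearCombination A (rightMulBasis cs a j)

theorem leftMul_single (i : B) (w : W) (c : A) :
    leftMul cs a i (Finsupp.single w c) = (cs.simple i • c) • leftMulBasis cs a i w :=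
  Finsupp.liftAddHom_apply_single _ _ _

theorem leftMul_single_one (i : B) (w : W) :
    leftMul cs a i (Finsupp.single w 1) = leftMulBasis cs a i w := by
  rw [leftMul_single, smul_one, one_smul]

theorem rightMul_single_one (j : B) (w : W) :
    rightMul cs a j (Finsupp.single w 1) = rightMulBasis cs a j w := by
  rw [rightMul, Finsupp.linearCombination_single, one_smul]

theorem leftMul_smul (i : B) (c : A) (v : W →₀ A) :
    leftMul cs a i (c • v) = (cs.simple i • c) • leftMul cs a i v := by
  induction v using Finsupp.induction_linear with
  | zero => simp
  | add v v' h h' => rw [smul_add, map_add, h, h', map_add, smul_add]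
  | single w d =>
    rw [Finsupp.smul_single, leftMul_single, leftMul_single, smul_eq_mul, smul_mul', smul_smul]

variable {cs a}

theorem leftMul_leftMulBasis (ha : cs.IsEquivariant a) (i : B) (w : W) :
    leftMul cs a i (leftMulBasis cs a i w) =
      (a i : A) • Finsupp.single w 1 + (1 - (a i : A)) • leftMulBasis cs a i w := by
  by_cases h : cs.IsLeftDescent w i
  · have h_mul := cs.isLeftDescent_iff_not_isLeftDescent_mul.1 h
    conv_lhs => rw [leftMulBasis_of_isLeftDescent a h]
    rw [map_add, leftMul_smul, leftMul_smul, leftMul_single_one, leftMul_single_one,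
      leftMulBasis_of_not_isLeftDescent a h_mul, simple_mul_simple_cancel_left, smul_sub, smul_one,
      simple_smul_of_isEquivariant ha]
  · have h_mul : cs.IsLeftDescent (cs.simple i * w) i := by
      rwa [cs.isLeftDescent_iff_not_isLeftDescent_mul, simple_mul_simple_cancel_left]
    rw [leftMulBasis_of_not_isLeftDescent a h, leftMul_single_one,
      leftMulBasis_of_isLeftDescent a h_mul, simple_mul_simple_cancel_left]

theorem leftMul_leftMul (ha : cs.IsEquivariant a) (hd : AnnihilatesDifferences cs a) (i : B)
    (v : W →₀ A) :
    leftMul cs a i (leftMul cs a i v) = (a i : A) • v + (1 - (a i : A)) • leftMul cs a i v := by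
  induction v using Finsupp.induction_linear with
  | zero => simp
  | add v v' h h' => rw [map_add, map_add, h, h']; module
  | single w c =>
    rw [leftMul_single, leftMul_smul, leftMul_leftMulBasis ha, smul_smul (1 - (a i : A)), hd,
      smul_smul, simple_mul_simple_self, one_smul, ← Finsupp.smul_single_one w c]
    module

theorem isLeftDescent_mul_simple_iff {i j : B} {w : W} (h : cs.simple i * w ≠ w * cs.simple j) :
    cs.IsLeftDescent (w * cs.simple j) i ↔ cs.IsLeftDescent w i := by
  have hi := cs.length_simple_mul w i
  have hj := cs.length_mul_simple w j
  have hij := cs.length_mul_simple (cs.simple i * w) j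
  have hji := cs.length_simple_mul (w * cs.simple j) i
  have hne := mt (simple_mul_eq_mul_simple_of_length_eq cs (w := w) (i := i) (j := j))
  simp only [IsLeftDescent, mul_assoc] at *
  grind

theorem isRightDescent_simple_mul_iff {i j : B} {w : W} (h : cs.simple i * w ≠ w * cs.simple j) :
    cs.IsRightDescent (cs.simple i * w) j ↔ cs.IsRightDescent w j := by
  have h_inv : cs.simple j * w⁻¹ ≠ w⁻¹ * cs.simple i := by
    simpa [← inv_inj (a := cs.simple j * w⁻¹)] using h.symm
  simpa [← cs.isLeftDescent_inv_iff] using isLeftDescent_mul_simple_iff h_inv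

theorem smul_eq_of_simple_mul_eq_mul_simple (ha : cs.IsEquivariant a) {i j : B} {w : W}
    (h : cs.simple i * w = w * cs.simple j) : w • (a j : A) = a i :=
  ha j i w (by rw [← h, mul_inv_cancel_right])

theorem rightMulBasis_eq_leftMulBasis (ha : cs.IsEquivariant a) {i j : B} {w : W}
    (h : cs.simple i * w = w * cs.simple j) : rightMulBasis cs a j w = leftMulBasis cs a i w := by
  simp only [rightMulBasis, leftMulBasis, IsRightDescent, IsLeftDescent, h,
    smul_eq_of_simple_mul_eq_mul_simple ha h]

theorem leftMul_rightMulBasis_of_eq (ha : cs.IsEquivariant a) {i j : B} {w : W}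
    (h : cs.simple i * w = w * cs.simple j) :
    leftMul cs a i (rightMulBasis cs a j w) = rightMul cs a j (leftMulBasis cs a i w) := by
  have h_mul : cs.simple i * (cs.simple i * w) = cs.simple i * w * cs.simple j := by
    rw [mul_assoc, ← h]
  have hw := rightMulBasis_eq_leftMulBasis ha h
  have hiw := rightMulBasis_eq_leftMulBasis ha h_mul
  rw [hw]
  by_cases hdesc : cs.IsLeftDescent w i
  · simp only [leftMulBasis_of_isLeftDescent a hdesc, map_add, leftMul_smul, map_smul,
      leftMul_single_one, rightMul_single_one, hw, hiw, smul_sub, smul_one,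
      simple_smul_of_isEquivariant ha]
  · rw [leftMulBasis_of_not_isLeftDescent a hdesc, leftMul_single_one, rightMul_single_one, hiw]

theorem leftMul_rightMulBasis_of_ne (hd : AnnihilatesDifferences cs a) {i j : B} {w : W}
    (h : cs.simple i * w ≠ w * cs.simple j) :
    leftMul cs a i (rightMulBasis cs a j w) = rightMul cs a j (leftMulBasis cs a i w) := by
  have h_left := isLeftDescent_mul_simple_iff h
  have h_right := isRightDescent_simple_mul_iff h
  have h_diff := hd i (w • (a j : A))
  by_cases hi : cs.IsLeftDescent w i <;> by_cases hj : cs.IsRightDescent w j <;>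
    simp only [leftMulBasis, rightMulBasis, h_left, h_right, hi, hj, if_true, if_false, map_add,
      leftMul_smul, map_smul, leftMul_single_one, rightMul_single_one, smul_sub, smul_one,
      mul_smul, mul_assoc]
  match_scalars
  · ring
  · linear_combination h_diff
  · ring
  · linear_combination -h_diff

theorem leftMul_rightMul (ha : cs.IsEquivariant a) (hd : AnnihilatesDifferences cs a) (i j : B)
    (v : W →₀ A) :
    leftMul cs a i (rightMul cs a j v) = rightMul cs a j (leftMul cs a i v) := by
  induction v using Finsupp.induction_linear with
  | zero => simp
  | add v v' h h' => rw [map_add, map_add, h, h', map_add, map_add]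
  | single w c =>
    have h_basis : leftMul cs a i (rightMulBasis cs a j w) =
        rightMul cs a j (leftMulBasis cs a i w) :=
      (eq_or_ne _ _).elim (leftMul_rightMulBasis_of_eq ha) (leftMul_rightMulBasis_of_ne hd)
    rw [← Finsupp.smul_single_one, map_smul, leftMul_smul, leftMul_smul, map_smul,
      leftMul_single_one, rightMul_single_one, h_basis]

theorem prod_leftMul_rightMul (ha : cs.IsEquivariant a) (hd : AnnihilatesDifferences cs a)
    (ω : List B) (j : B) (v : W →₀ A) :
    (ω.map (leftMul cs a)).prod (rightMul cs a j v) =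
      rightMul cs a j ((ω.map (leftMul cs a)).prod v) := by
  induction ω with
  | nil => rfl
  | cons i ω ih =>
    rw [List.map_cons, List.prod_cons, AddMonoid.End.coe_mul, Function.comp_apply,
      Function.comp_apply, ih, leftMul_rightMul ha hd]

variable (cs a) in
theorem prod_leftMul_smul (ω : List B) (c : A) (v : W →₀ A) :
    (ω.map (leftMul cs a)).prod (c • v) =
      (cs.wordProd ω • c) • (ω.map (leftMul cs a)).prod v := by
  induction ω with
  | nil => simp
  | cons i ω ih =>
    rw [List.map_cons, List.prod_cons, AddMonoid.End.coe_mul, Function.comp_apply,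
      Function.comp_apply, ih, leftMul_smul, wordProd_cons, mul_smul]

variable (a) in
theorem prod_leftMul_single_one {ω : List B} (hω : cs.IsReduced ω) :
    (ω.map (leftMul cs a)).prod (Finsupp.single 1 1) = Finsupp.single (cs.wordProd ω) 1 := by
  induction ω with
  | nil => simp
  | cons i ω ih =>
    have hω_tail : cs.IsReduced ω := by simpa using hω.drop 1
    have hdesc : ¬cs.IsLeftDescent (cs.wordProd ω) i := by
      rw [not_isLeftDescent_iff, ← wordProd_cons, hω.eq, hω_tail.eq, List.length_cons]
    rw [List.map_cons, List.prod_cons, AddMonoid.End.coe_mul, Function.comp_apply, ih hω_tail,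
      leftMul_single_one, leftMulBasis_of_not_isLeftDescent a hdesc, wordProd_cons]

theorem apply_single_one_eq_of_comm_rightMul {φ ψ : AddMonoid.End (W →₀ A)}
    (hφ : ∀ j v, φ (rightMul cs a j v) = rightMul cs a j (φ v))
    (hψ : ∀ j v, ψ (rightMul cs a j v) = rightMul cs a j (ψ v))
    (h : φ (Finsupp.single 1 1) = ψ (Finsupp.single 1 1)) (w : W) :
    φ (Finsupp.single w 1) = ψ (Finsupp.single w 1) := by
  obtain ⟨u, hu, rfl⟩ := cs.exists_isReduced w
  induction u using List.reverseRecOn with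
  | nil => rwa [wordProd_nil]
  | append_singleton u j ih =>
    have hdesc : ¬cs.IsRightDescent (cs.wordProd u) j := by
      rw [isRightDescent_iff_not_isRightDescent_mul, not_not, ← wordProd_singleton,
        ← wordProd_append]
      exact isRightDescent_of_singleton_suffix hu (List.suffix_append u [j])
    have h_single : Finsupp.single (cs.wordProd (u ++ [j])) (1 : A) =
        rightMul cs a j (Finsupp.single (cs.wordProd u) 1) := by
      rw [rightMul_single_one, rightMulBasis_of_not_isRightDescent a hdesc, wordProd_append,
        wordProd_singleton]
    rw [h_single, hφ, hψ, ih (isReduced_of_isReduced_append_left hu)]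

theorem prod_leftMul_eq_of_isReduced (ha : cs.IsEquivariant a) (hd : AnnihilatesDifferences cs a)
    {ω τ : List B} (hω : cs.IsReduced ω) (hτ : cs.IsReduced τ)
    (h : cs.wordProd ω = cs.wordProd τ) :
    (ω.map (leftMul cs a)).prod = (τ.map (leftMul cs a)).prod := by
  ext1 v
  induction v using Finsupp.induction_linear with
  | zero => simp
  | add v v' h h' => rw [map_add, map_add, h, h']
  | single w c =>
    have h_one : (ω.map (leftMul cs a)).prod (Finsupp.single 1 1) =
        (τ.map (leftMul cs a)).prod (Finsupp.single 1 1) := by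
      rw [prod_leftMul_single_one a hω, prod_leftMul_single_one a hτ, h]
    rw [← Finsupp.smul_single_one, prod_leftMul_smul, prod_leftMul_smul, h,
      apply_single_one_eq_of_comm_rightMul (prod_leftMul_rightMul ha hd ω)
        (prod_leftMul_rightMul ha hd τ) h_one]

theorem prod_leftMul_braidWord (ha : cs.IsEquivariant a) (hd : AnnihilatesDifferences cs a)
    (i j : B) :
    ((braidWord M i j).map (leftMul cs a)).prod = ((braidWord M j i).map (leftMul cs a)).prod :=
  prod_leftMul_eq_of_isReduced ha hd (isReduced_braidWord cs i j) (isReduced_braidWord cs j i)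
    (cs.wordProd_braidWord_eq i j)

end Multiplication

section Spanning

/-- The canonical map from the Artin group to the Marin ring. -/
noncomputable def ofArtin : cs.ArtinGroup →* cs.MarinRing a :=
  (Ideal.Quotient.mk (cs.heckeIdeal a).asIdeal : cs.CrossedProduct A →* cs.MarinRing a).comp
    (SkewMonoidAlgebra.of A cs.ArtinGroup)

theorem ofArtin_artinSection (w : W) : ofArtin cs a (cs.artinSection w) = cs.marinG a w := rfl

theorem ofArtin_artinGen (i : B) :
    ofArtin cs a (cs.artinGen i) = cs.marinG a (cs.simple i) := by
  rw [← ofArtin_artinSection, artinSection_simple]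

theorem single_one_mul (c : A) (x : cs.CrossedProduct A) :
    SkewMonoidAlgebra.single 1 c * x = c • x := by
  rw [← smul_one_mul c x, SkewMonoidAlgebra.one_def, SkewMonoidAlgebra.smul_single, smul_eq_mul,
    mul_one]

theorem ofArtin_mul_smul (b : cs.ArtinGroup) (c : A) (x : cs.MarinRing a) :
    ofArtin cs a b * c • x = (cs.artinProj b • c) • (ofArtin cs a b * x) := by
  obtain ⟨y, rfl⟩ := Ideal.Quotient.mk_surjective x
  have h : SkewMonoidAlgebra.single b 1 * c • y =
      (cs.artinProj b • c) • (SkewMonoidAlgebra.single b 1 * y) := by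
    rw [← single_one_mul, ← single_one_mul, ← mul_assoc, ← mul_assoc,
      SkewMonoidAlgebra.single_mul_single, SkewMonoidAlgebra.single_mul_single,
      artinGroup_smul_def, smul_one, mul_one, mul_one, one_mul, one_mul]
  exact congrArg (Ideal.Quotient.mk (cs.heckeIdeal a).asIdeal) h

theorem ofArtin_artinGen_mul_self (i : B) :
    ofArtin cs a (cs.artinGen i) * ofArtin cs a (cs.artinGen i) =
      (a i : A) • 1 + (1 - (a i : A)) • ofArtin cs a (cs.artinGen i) := by
  have h : Ideal.Quotient.mk (cs.heckeIdeal a).asIdeal (cs.heckeRelator a i) = 0 := by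
    rw [Ideal.Quotient.eq_zero_iff_mem, TwoSidedIdeal.mem_asIdeal]
    exact TwoSidedIdeal.subset_span ⟨i, rfl⟩
  rw [CoxeterSystem.heckeRelator, single_one_mul, ← mul_one (SkewMonoidAlgebra.single 1 _),
    single_one_mul, map_sub, map_sub, map_pow, sq, sub_sub, sub_eq_zero] at h
  exact h

theorem ofArtin_artinGen_inv (i : B) :
    ofArtin cs a (cs.artinGen i)⁻¹ =
      ((a i)⁻¹ : Aˣ).val • (ofArtin cs a (cs.artinGen i) - (1 - (a i : A)) • 1) := by
  have h : (a i : A) • ofArtin cs a (cs.artinGen i)⁻¹ =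
      ofArtin cs a (cs.artinGen i) - (1 - (a i : A)) • 1 := by
    have h_sq := congrArg (· * ofArtin cs a (cs.artinGen i)⁻¹) (ofArtin_artinGen_mul_self cs a i)
    simp only [add_mul, smul_mul_assoc, one_mul, mul_assoc, ← map_mul, mul_inv_cancel, map_one,
      mul_one] at h_sq
    exact eq_sub_of_add_eq h_sq.symm
  rw [← h, smul_smul, Units.inv_mul, one_smul]

theorem marinG_mem_span (w : W) : cs.marinG a w ∈ Submodule.span A (Set.range (cs.marinG a)) :=
  Submodule.subset_span ⟨w, rfl⟩

theorem marinG_mul_smul (w : W) (c : A) (x : cs.MarinRing a) :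
    cs.marinG a w * c • x = (w • c) • (cs.marinG a w * x) := by
  rw [← ofArtin_artinSection, ofArtin_mul_smul, cs.artinProj_artinSection]

theorem marinG_mul_artinGen_of_not_isRightDescent {w : W} {i : B} (h : ¬cs.IsRightDescent w i) :
    cs.marinG a w * ofArtin cs a (cs.artinGen i) = cs.marinG a (w * cs.simple i) := by
  rw [← ofArtin_artinSection, ← map_mul, artinSection_mul_artinGen cs h, ofArtin_artinSection]

theorem marinG_mul_artinGen_mem_span (w : W) (i : B) :
    cs.marinG a w * ofArtin cs a (cs.artinGen i) ∈
      Submodule.span A (Set.range (cs.marinG a)) := by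
  by_cases h : cs.IsRightDescent w i
  · have h_mul := marinG_mul_artinGen_of_not_isRightDescent cs a
      (cs.isRightDescent_iff_not_isRightDescent_mul.1 h)
    rw [simple_mul_simple_cancel_right] at h_mul
    rw [← h_mul, mul_assoc, ofArtin_artinGen_mul_self, mul_add, marinG_mul_smul, marinG_mul_smul,
      mul_one, h_mul]
    exact add_mem (Submodule.smul_mem _ _ (marinG_mem_span cs a _))
      (Submodule.smul_mem _ _ (marinG_mem_span cs a _))
  · rw [marinG_mul_artinGen_of_not_isRightDescent cs a h]
    exact marinG_mem_span cs a _

theorem marinG_mul_artinGen_inv_mem_span (w : W) (i : B) :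
    cs.marinG a w * ofArtin cs a (cs.artinGen i)⁻¹ ∈
      Submodule.span A (Set.range (cs.marinG a)) := by
  rw [ofArtin_artinGen_inv, marinG_mul_smul, mul_sub, marinG_mul_smul, mul_one]
  exact Submodule.smul_mem _ _ (sub_mem (marinG_mul_artinGen_mem_span cs a w i)
    (Submodule.smul_mem _ _ (marinG_mem_span cs a w)))

variable {cs a} in
theorem mul_mem_span_marinG {y : cs.MarinRing a}
    (hy : ∀ w, cs.marinG a w * y ∈ Submodule.span A (Set.range (cs.marinG a)))
    {x : cs.MarinRing a} (hx : x ∈ Submodule.span A (Set.range (cs.marinG a))) :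
    x * y ∈ Submodule.span A (Set.range (cs.marinG a)) := by
  induction hx using Submodule.span_induction with
  | mem x h =>
    obtain ⟨w, rfl⟩ := h
    exact hy w
  | zero =>
    rw [zero_mul]
    exact zero_mem _
  | add x x' _ _ h h' =>
    rw [add_mul]
    exact add_mem h h'
  | smul c x _ h =>
    rw [smul_mul_assoc]
    exact Submodule.smul_mem _ _ h

theorem mul_ofArtin_mem_span (b : cs.ArtinGroup) {x : cs.MarinRing a}
    (hx : x ∈ Submodule.span A (Set.range (cs.marinG a))) :
    x * ofArtin cs a b ∈ Submodule.span A (Set.range (cs.marinG a)) := by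
  induction mem_closure_range_artinGen cs b using Subgroup.closure_induction'' generalizing x with
  | mem b h =>
    obtain ⟨i, rfl⟩ := h
    exact mul_mem_span_marinG (marinG_mul_artinGen_mem_span cs a · i) hx
  | inv_mem b h =>
    obtain ⟨i, rfl⟩ := h
    exact mul_mem_span_marinG (marinG_mul_artinGen_inv_mem_span cs a · i) hx
  | one => simpa using hx
  | mul b b' _ _ h h' =>
    rw [map_mul, ← mul_assoc]
    exact h' (h hx)

theorem span_range_marinG : Submodule.span A (Set.range (cs.marinG a)) = ⊤ := by
  rw [Submodule.eq_top_iff']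
  intro x
  obtain ⟨y, rfl⟩ := Ideal.Quotient.mk_surjective x
  induction y using SkewMonoidAlgebra.induction_on with
  | zero =>
    rw [map_zero]
    exact zero_mem _
  | single b c =>
    have h_one : (1 : cs.MarinRing a) ∈ Submodule.span A (Set.range (cs.marinG a)) := by
      rw [← map_one (ofArtin cs a), ← artinSection_one]
      exact marinG_mem_span cs a 1
    have h_mk : Ideal.Quotient.mk (cs.heckeIdeal a).asIdeal (SkewMonoidAlgebra.single b c) =
        c • ofArtin cs a b := by
      rw [← SkewMonoidAlgebra.smul_of]
      rfl
    rw [h_mk, ← one_mul (ofArtin cs a b)]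
    exact Submodule.smul_mem _ c (mul_ofArtin_mem_span cs a b h_one)
  | add f g hf hg =>
    rw [map_add]
    exact add_mem hf hg

theorem smul_marinG_simple_eq (i : B) (c : A) :
    ((1 - (a i : A)) * (cs.simple i • c)) • cs.marinG a (cs.simple i) =
      ((1 - (a i : A)) * c) • cs.marinG a (cs.simple i) := by
  -- Both sides arise from `gᵢ² c = c gᵢ²` by expanding `gᵢ²`.
  set g := ofArtin cs a (cs.artinGen i) with hg
  have hg_smul (d : A) (x : cs.MarinRing a) : g * d • x = (cs.simple i • d) • (g * x) := by
    rw [hg, ofArtin_mul_smul, cs.artinProj_artinGen]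
  have hg_sq : g * g = (a i : A) • 1 + (1 - (a i : A)) • g := ofArtin_artinGen_mul_self cs a i
  have h : g * g * c • 1 = c • (g * g) := by
    rw [mul_assoc, hg_smul, hg_smul, mul_one, smul_smul (cs.simple i), simple_mul_simple_self,
      one_smul]
  rw [hg_sq, add_mul, smul_mul_assoc, smul_mul_assoc, one_mul, hg_smul, mul_one, smul_add,
    smul_smul, smul_smul, smul_smul, smul_smul, mul_comm c, mul_comm c] at h
  rw [← ofArtin_artinGen]
  exact add_left_cancel h

theorem annihilatesDifferences_of_basis (b : Module.Basis W A (cs.MarinRing a))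
    (hb : ∀ w, b w = cs.marinG a w) : AnnihilatesDifferences cs a := by
  intro i c
  have h := congrArg (b.repr · (cs.simple i)) (smul_marinG_simple_eq cs a i c)
  simpa only [← hb, map_smul, Module.Basis.repr_self, Finsupp.smul_single, smul_eq_mul, mul_one,
    Finsupp.single_eq_same] using h

end Spanning

section Representation

/-- A root `x` of a quadratic equation with invertible constant term, as a unit. -/
def unitOfQuadratic {R : Type*} [Ring R] {x p q r : R} (h : x * x = p + q * x)
    (hq : x * q = q * x) (hr : x * r = r * x) (hrp : r * p = 1) : Rˣ where
  val := x
  inv := r * (x - q)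
  val_inv := by rw [← mul_assoc, hr, mul_assoc, mul_sub, h, hq, add_sub_cancel_right, hrp]
  inv_val := by rw [mul_assoc, sub_mul, h, add_sub_cancel_right, hrp]

theorem leftMul_mul_toAddMonoidEnd (i : B) (c : A) :
    leftMul cs a i * Module.toAddMonoidEnd A (W →₀ A) c =
      Module.toAddMonoidEnd A (W →₀ A) (cs.simple i • c) * leftMul cs a i :=
  AddMonoidHom.ext (leftMul_smul cs a i c)

variable {cs a}

theorem leftMul_mul_self (ha : cs.IsEquivariant a) (hd : AnnihilatesDifferences cs a) (i : B) :
    leftMul cs a i * leftMul cs a i = Module.toAddMonoidEnd A (W →₀ A) (a i)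
      + Module.toAddMonoidEnd A (W →₀ A) (1 - a i) * leftMul cs a i :=
  AddMonoidHom.ext (leftMul_leftMul ha hd i)

/-- Left multiplication by `gᵢ` as an invertible endomorphism. -/
noncomputable def leftMulUnit (ha : cs.IsEquivariant a) (hd : AnnihilatesDifferences cs a)
    (i : B) : (AddMonoid.End (W →₀ A))ˣ :=
  unitOfQuadratic (leftMul_mul_self ha hd i)
    (r := Module.toAddMonoidEnd A (W →₀ A) ↑(a i)⁻¹)
    (by rw [leftMul_mul_toAddMonoidEnd, smul_sub, smul_one, simple_smul_of_isEquivariant ha])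
    (by rw [leftMul_mul_toAddMonoidEnd, simple_smul_inv_of_isEquivariant ha])
    (by rw [← map_mul, Units.inv_mul, map_one])

theorem coe_prod_leftMulUnit (ha : cs.IsEquivariant a) (hd : AnnihilatesDifferences cs a)
    (ω : List B) :
    ((ω.map (leftMulUnit ha hd)).prod : AddMonoid.End (W →₀ A)) =
      (ω.map (leftMul cs a)).prod := by
  rw [← Units.coeHom_apply, map_list_prod, List.map_map]
  rfl

/-- The representation of the Artin group on the free module with basis `(g_w)`. -/
noncomputable def artinRep (ha : cs.IsEquivariant a) (hd : AnnihilatesDifferences cs a) :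
    cs.ArtinGroup →* (AddMonoid.End (W →₀ A))ˣ :=
  artinLift cs (leftMulUnit ha hd) fun i j => Units.ext <| by
    rw [coe_prod_leftMulUnit, coe_prod_leftMulUnit, prod_leftMul_braidWord ha hd]

theorem coe_artinRep_artinGen (ha : cs.IsEquivariant a) (hd : AnnihilatesDifferences cs a)
    (i : B) : (artinRep ha hd (cs.artinGen i) : AddMonoid.End (W →₀ A)) = leftMul cs a i :=
  congrArg Units.val (artinLift_artinGen cs _ i)

theorem coe_artinRep_artinSection (ha : cs.IsEquivariant a) (hd : AnnihilatesDifferences cs a)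
    {ω : List B} (hω : cs.IsReduced ω) :
    (artinRep ha hd (cs.artinSection (cs.wordProd ω)) : AddMonoid.End (W →₀ A)) =
      (ω.map (leftMul cs a)).prod := by
  have h_comp : artinRep ha hd ∘ cs.artinGen = leftMulUnit ha hd :=
    funext (artinLift_artinGen cs _)
  rw [artinSection_wordProd cs hω, map_list_prod, List.map_map, h_comp, coe_prod_leftMulUnit]

theorem toAddMonoidEnd_mul_artinRep (ha : cs.IsEquivariant a) (hd : AnnihilatesDifferences cs a)
    (b : cs.ArtinGroup) (c : A) :
    Module.toAddMonoidEnd A (W →₀ A) (b • c) * artinRep ha hd b =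
      artinRep ha hd b * Module.toAddMonoidEnd A (W →₀ A) c := by
  induction mem_closure_range_artinGen cs b using Subgroup.closure_induction generalizing c with
  | mem b h =>
    obtain ⟨i, rfl⟩ := h
    rw [coe_artinRep_artinGen, leftMul_mul_toAddMonoidEnd, cs.artinGroup_smul_def,
      cs.artinProj_artinGen]
  | one => simp
  | mul b b' _ _ h h' =>
    rw [map_mul, Units.val_mul, ← mul_assoc, mul_smul, h, mul_assoc, h', mul_assoc]
  | inv b _ h =>
    rw [map_inv, Units.mul_inv_eq_iff_eq_mul, mul_assoc, Units.eq_inv_mul_iff_mul_eq, ← h,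
      smul_inv_smul]

/-- The representation of the skew group ring on the free module with basis `(g_w)`. -/
noncomputable def crossedProductRep (ha : cs.IsEquivariant a)
    (hd : AnnihilatesDifferences cs a) : cs.CrossedProduct A →+* AddMonoid.End (W →₀ A) :=
  SkewMonoidAlgebra.liftNCRingHom (Module.toAddMonoidEnd A (W →₀ A))
    ((Units.coeHom _).comp (artinRep ha hd))
    (fun {c b} => toAddMonoidEnd_mul_artinRep ha hd b c)

theorem crossedProductRep_single (ha : cs.IsEquivariant a) (hd : AnnihilatesDifferences cs a)
    (b : cs.ArtinGroup) (c : A) :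
    crossedProductRep ha hd (SkewMonoidAlgebra.single b c) =
      Module.toAddMonoidEnd A (W →₀ A) c * artinRep ha hd b :=
  SkewMonoidAlgebra.liftNC_single _ _ _ _

theorem crossedProductRep_smul (ha : cs.IsEquivariant a) (hd : AnnihilatesDifferences cs a)
    (c : A) (x : cs.CrossedProduct A) :
    crossedProductRep ha hd (c • x) =
      Module.toAddMonoidEnd A (W →₀ A) c * crossedProductRep ha hd x := by
  rw [← single_one_mul, map_mul, crossedProductRep_single, map_one, Units.val_one, mul_one]

theorem crossedProductRep_heckeRelator (ha : cs.IsEquivariant a)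
    (hd : AnnihilatesDifferences cs a) (i : B) :
    crossedProductRep ha hd (cs.heckeRelator a i) = 0 := by
  simp only [CoxeterSystem.heckeRelator, map_sub, map_mul, crossedProductRep_single,
    coe_artinRep_artinGen, map_one, Units.val_one, one_mul, mul_one, sq]
  rw [leftMul_mul_self ha hd, map_sub, map_one, sub_sub, sub_self]

/-- The representation of the Marin ring on the free module with basis `(g_w)`. -/
noncomputable def marinRep (ha : cs.IsEquivariant a) (hd : AnnihilatesDifferences cs a) :
    cs.MarinRing a →+* AddMonoid.End (W →₀ A) :=
  Ideal.Quotient.lift _ (crossedProductRep ha hd) fun x hx => by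
    have h : cs.heckeIdeal a ≤ TwoSidedIdeal.ker (crossedProductRep ha hd) := by
      rw [CoxeterSystem.heckeIdeal, TwoSidedIdeal.span_le]
      rintro _ ⟨i, rfl⟩
      exact (TwoSidedIdeal.mem_ker _).2 (crossedProductRep_heckeRelator ha hd i)
    exact (TwoSidedIdeal.mem_ker _).1 (h (TwoSidedIdeal.mem_asIdeal.1 hx))

theorem marinRep_smul (ha : cs.IsEquivariant a) (hd : AnnihilatesDifferences cs a) (c : A)
    (x : cs.MarinRing a) :
    marinRep ha hd (c • x) = Module.toAddMonoidEnd A (W →₀ A) c * marinRep ha hd x := by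
  obtain ⟨y, rfl⟩ := Ideal.Quotient.mk_surjective x
  exact crossedProductRep_smul ha hd c y

/-- The orbit map `x ↦ x • e₁` from the Marin ring to the free module with basis `(g_w)`. -/
noncomputable def marinOrbit (ha : cs.IsEquivariant a) (hd : AnnihilatesDifferences cs a) :
    cs.MarinRing a →ₗ[A] (W →₀ A) where
  toFun x := marinRep ha hd x (Finsupp.single 1 1)
  map_add' x y := by
    rw [map_add]
    rfl
  map_smul' c x := by
    rw [marinRep_smul]
    rfl

theorem marinOrbit_marinG (ha : cs.IsEquivariant a) (hd : AnnihilatesDifferences cs a) (w : W) :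
    marinOrbit ha hd (cs.marinG a w) = Finsupp.single w 1 := by
  obtain ⟨ω, hω, rfl⟩ := cs.exists_isReduced w
  have h_rep : marinRep ha hd (cs.marinG a (cs.wordProd ω)) = (ω.map (leftMul cs a)).prod := by
    rw [← coe_artinRep_artinSection ha hd hω]
    refine (crossedProductRep_single ha hd _ 1).trans ?_
    rw [map_one, one_mul]
  rw [← prod_leftMul_single_one a hω, ← h_rep]
  rfl

theorem linearIndependent_marinG (ha : cs.IsEquivariant a) (hd : AnnihilatesDifferences cs a) :
    LinearIndependent A (cs.marinG a) := by
  have h_comp : marinOrbit ha hd ∘ cs.marinG a = fun w => Finsupp.single w 1 :=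
    funext (marinOrbit_marinG ha hd)
  refine LinearIndependent.of_comp (marinOrbit ha hd) ?_
  rw [h_comp]
  exact Finsupp.linearIndependent_single_one A W

end Representation

end MarinRing

theorem one_sub_mulLeft_mul_one_sub_smul_eq_zero_iff {k G A : Type*} [CommRing k] [Ring A]
    [Algebra k A] [Monoid G] [DistribMulAction G A] [SMulCommClass G k A] (x : A) (g : G) :
    (1 - LinearMap.mulLeft k x) * (1 - DistribSMul.toLinearMap k A g) = (0 : Module.End k A) ↔
      ∀ c : A, (1 - x) * (g • c) = (1 - x) * c := by
  refine LinearMap.ext_iff.trans (forall_congr' fun c => ?_)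
  have h : ((1 - LinearMap.mulLeft k x) * (1 - DistribSMul.toLinearMap k A g)) c =
      (1 - x) * c - (1 - x) * (g • c) := by
    simp only [Module.End.mul_apply, LinearMap.sub_apply, Module.End.one_apply,
      LinearMap.mulLeft_apply, DistribSMul.toLinearMap_apply]
    noncomm_ring
  rw [h, LinearMap.zero_apply, sub_eq_zero, eq_comm]

theorem mainTheorem1_general {B W A : Type*} [Group W] {M : CoxeterMatrix B}
    (cs : CoxeterSystem M W) [CommRing A] [MulSemiringAction W A] (a : B → Aˣ)
    (ha : cs.IsEquivariant a) :
    (∃ b : Module.Basis W A (cs.MarinRing a), ∀ w : W, b w = cs.marinG a w) ↔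
      ∀ (i : B) (c : A), (1 - (a i : A)) * (cs.simple i • c) = (1 - (a i : A)) * c := by
  constructor
  · rintro ⟨b, hb⟩
    exact MarinRing.annihilatesDifferences_of_basis cs a b hb
  · intro hd
    exact ⟨Module.Basis.mk (MarinRing.linearIndependent_marinG ha hd)
      (MarinRing.span_range_marinG cs a).ge, Module.Basis.mk_apply _ _⟩

theorem mainTheorem1 {B W k A : Type*} [Group W] {M : CoxeterMatrix B} (cs : CoxeterSystem M W)
    [CommRing k] [CommRing A] [Algebra k A] [Module.Free k A]
    [MulSemiringAction W A] [SMulCommClass W k A]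
    (a : B → Aˣ) (ha : cs.IsEquivariant a) :
    (∃ b : Module.Basis W A (cs.MarinRing a), ∀ w : W, b w = cs.marinG a w) ↔
      ∀ i : B, (1 - LinearMap.mulLeft k (a i : A)) *
        (1 - DistribSMul.toLinearMap k A (cs.simple i)) = (0 : Module.End k A) := by
  simp only [one_sub_mulLeft_mul_one_sub_smul_eq_zero_iff, mainTheorem1_general cs a ha]
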